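/- Let $\Re_+^2=\{(x,y)\in\Re^2 : x\ge 0,\ y\ge 0\}$, let $D_r(o)$ denote the closed disk of radius $r$ centered at $o$, and let $\hat D_1(o)=D_1(o)\cap\Re_+^2$ be the truncated unit disk around $o$. There is an absolute constant $c>0$ (independent of $o$, $w$ and $b$) with the following property. Let $w$ and $b$ be positive integers with $w<b(\log b)^{3/2}$, put $\delta=\dfrac{1}{b^{1/3}\log b}$, and let $o$ be a point with $D_\delta(o)\subseteq\Re_+^2$. Select $w+b$ points independently and uniformly at random from $\hat D_1(o)$, color the first $w$ of them white and the remaining $b$ blue, and let $\hat{\mathcal H}_{w,b}$ be the graph on these $w+b$ points in which two different points are adjacent if and only if the distance between them is at most one. Then, with probability at least $1-\dfrac{c}{(\log b)^{3/2}}$, the graph $\hat{\mathcal H}_{w,b}$ has a connected dominating set that consists of two adjacent blue vertices lying in $D_\delta(o)$. (A connected dominating set of a graph is a set $C$ of vertices such that every vertex is in $C$ or adjacent to a vertex in $C$ and such that the subgraph induced by $C$ is connected.) -/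

import Mathlib

open MeasureTheory ProbabilityTheory

noncomputable section

namespace UnitDisk

/-- The Euclidean plane. -/
abbrev Plane : Type := EuclideanSpace ℝ (Fin 2)

/-- The closed first quadrant of the plane. -/
def quadrant : Set Plane := {p | 0 ≤ p 0 ∧ 0 ≤ p 1}

/-- The closed disk of radius `r` centered at `o`. -/
def disk (r : ℝ) (o : Plane) : Set Plane := Metric.closedBall o r

/-- The truncated unit disk around `o`: the part of the closed unit disk in the quadrant. -/
def truncDisk (o : Plane) : Set Plane := disk 1 o ∩ quadrant

/-- The small radius `δ = 1 / (b ^ (1/3) * log b)`. -/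
def delta (b : ℕ) : ℝ := 1 / ((b : ℝ) ^ (1 / 3 : ℝ) * Real.log b)

/-- The uniform probability distribution on the truncated unit disk around `o`
(Lebesgue measure conditioned on that set). -/
def uniformTruncDisk (o : Plane) : Measure Plane := cond volume (truncDisk o)

/-- The vertices: `w` white ones (left summand) and `b` blue ones (right summand). -/
abbrev Vertex (w b : ℕ) : Type := Fin w ⊕ Fin b

/-- The joint law of the positions of the `w` white and `b` blue points: they are independent
and uniformly distributed on the truncated unit disk around `o`. -/
def law (w b : ℕ) (o : Plane) : Measure (Vertex w b → Plane) :=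
  Measure.pi fun _ => uniformTruncDisk o

/-- The unit disk graph of a family of points: two different vertices are adjacent iff the
distance between their positions is at most one. -/
def unitDiskGraph {V : Type*} (x : V → Plane) : SimpleGraph V where
  Adj u v := u ≠ v ∧ dist (x u) (x v) ≤ 1
  symm := ⟨fun u v h => ⟨h.1.symm, by rw [dist_comm]; exact h.2⟩⟩
  loopless := ⟨fun _ h => h.1 rfl⟩

/-- Every vertex is in `C` or adjacent to a vertex in `C`. -/
def IsDominating {V : Type*} (G : SimpleGraph V) (C : Set V) : Prop :=
  ∀ v, v ∈ C ∨ ∃ u ∈ C, G.Adj v u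

/-- A dominating set whose induced subgraph is connected. -/
def IsConnectedDominating {V : Type*} (G : SimpleGraph V) (C : Set V) : Prop :=
  IsDominating G C ∧ (G.induce C).Connected

/-- The point configurations whose unit disk graph has a connected dominating set that consists
of two (different) adjacent blue vertices located in the disk of radius `delta b` around `o`. -/
def localCDSEvent (w b : ℕ) (o : Plane) : Set (Vertex w b → Plane) :=
  {x | ∃ i j : Fin b,
    (unitDiskGraph x).Adj (Sum.inr i) (Sum.inr j) ∧
    x (Sum.inr i) ∈ disk (delta b) o ∧ x (Sum.inr j) ∈ disk (delta b) o ∧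
    IsConnectedDominating (unitDiskGraph x) {Sum.inr i, Sum.inr j}}

end UnitDisk

end

/-!
Work at a scale `r` much smaller than `δ`. Call blue points `p`, `q` near `o` *nearly antipodal* if
both are at distance about `r` from `o`, on opposite sides, with directions opposite up to an angle
`O(r)`. A point `o + v` of the unit disk that is missed by the unit disks around both `p` and `q`
has `⟪v, p - o⟫ = O(r ^ 2)` and `1 - ‖v‖ ^ 2 = O(r ^ 2)`
(`almost_orthogonal_of_uncovered`). Such `v` fill two regions of width `O(r)` and height
`O(r ^ 2)`, one in each half plane, so a random point is uncovered with probability only `O(r ^ 3)`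
(`uniform_uncovered_le`). If nothing is uncovered, `p` and `q` form the required connected
dominating set (`mem_localCDSEvent`).

A random pair is nearly antipodal with probability of order `r ^ 5`: `r ^ 2` for the position of
`p` and `r ^ 3` for the position of `q` given `p`. Two estimates remain.

* Some nearly antipodal blue pair exists, up to probability `O(1 / (b ^ 2 * r ^ 5))`, as long as
  `b * r ^ 3 ≤ 1`. This is the second moment method (`second_moment_array`,
  `no_nearAntipodal_pair_le`); the pairs take the first component from one half of the
  blue points and the second from another, so that they form a square array.
* No nearly antipodal pair misses a further point, up to probability
  `O(b ^ 2 * (w + b) * r ^ 5 * r ^ 3)`, by the union bound over all triples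
  (`one_sub_law_localCDSEvent_le`).

With `r = b ^ (-5 / 13)` both errors are at most `(log b) ^ (3 / 2) * b ^ (-1 / 13)` up to a
constant (`failure_bound`), which is far below `(log b) ^ (-3 / 2)` for large `b`. This `r` is also
below `δ / 3` for large `b`, and for small `b` the bound is trivial once the constant is large.

The cross product of `p - o` and `o - q` measures how far the pair is from antipodal.
Fixing one point and one coordinate of the other confines the remaining coordinate to an interval
of length of order `r ^ 2`, so all areas are computed by slicing.
-/

namespace UnitDisk

/-! ### Areas by slices, and the uniform distribution on the truncated disk -/

lemma dist_le_iff_sq (p q : Plane) {s : ℝ} (hs : 0 ≤ s) :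
    dist p q ≤ s ↔ (p 0 - q 0) ^ 2 + (p 1 - q 1) ^ 2 ≤ s ^ 2 := by
  rw [EuclideanSpace.dist_eq, Real.sqrt_le_left hs, Fin.sum_univ_two]
  simp [Real.dist_eq, sq_abs]

lemma volume_eq_lintegral_slice {S : Set Plane} (hS : MeasurableSet S) :
    volume S = ∫⁻ x : ℝ, volume {y : ℝ | !₂[x, y] ∈ S} := by
  have h := ((volume_preserving_finTwoArrow ℝ).comp (PiLp.volume_preserving_ofLp (Fin 2))).symm
    ((MeasurableEquiv.toLp 2 (Fin 2 → ℝ)).symm.trans MeasurableEquiv.finTwoArrow)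
  rw [← h.measure_preimage hS.nullMeasurableSet, Measure.volume_eq_prod,
    Measure.prod_apply (h.measurable hS)]
  rfl

/-- A planar set of width at most `d - c` whose vertical slices have diameter at most `t` has area
at most `(d - c) * t`. -/
lemma volume_le_of_slices {S : Set Plane} (hS : MeasurableSet S) {c d t : ℝ}
    (h0 : ∀ p ∈ S, p 0 ∈ Set.Icc c d)
    (h1 : ∀ p ∈ S, ∀ q ∈ S, p 0 = q 0 → |p 1 - q 1| ≤ t) :
    volume S ≤ ENNReal.ofReal (d - c) * ENNReal.ofReal t := by
  rw [volume_eq_lintegral_slice hS]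
  calc ∫⁻ x : ℝ, volume {y : ℝ | !₂[x, y] ∈ S}
      ≤ ∫⁻ x : ℝ, (Set.Icc c d).indicator (fun _ => ENNReal.ofReal t) x := by
        refine lintegral_mono fun x => ?_
        by_cases hx : x ∈ Set.Icc c d
        · rw [Set.indicator_of_mem hx]
          refine (Real.volume_le_diam _).trans (Metric.ediam_le fun y hy z hz => ?_)
          rw [edist_dist, Real.dist_eq]
          exact ENNReal.ofReal_le_ofReal (by simpa using h1 _ hy _ hz (by simp))
        · rw [Set.indicator_of_notMem hx]
          have : {y : ℝ | !₂[x, y] ∈ S} = ∅ := by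
            ext y
            simp only [Set.mem_ofPred_eq, Set.mem_empty_iff_false, iff_false]
            intro hy
            exact hx (by simpa using h0 _ hy)
          simp [this]
    _ = ENNReal.ofReal (d - c) * ENNReal.ofReal t := by
        rw [lintegral_indicator_const measurableSet_Icc, Real.volume_Icc, mul_comm]

/-- A planar set that contains, over each point of `[c, d]`, a vertical segment of length `t` has
area at least `(d - c) * t`. -/
lemma le_volume_of_slices {S : Set Plane} (hS : MeasurableSet S) {c d t : ℝ} (l : ℝ → ℝ)
    (h : ∀ x ∈ Set.Icc c d, ∀ y ∈ Set.Icc (l x) (l x + t), !₂[x, y] ∈ S) :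
    ENNReal.ofReal (d - c) * ENNReal.ofReal t ≤ volume S := by
  rw [volume_eq_lintegral_slice hS]
  calc ENNReal.ofReal (d - c) * ENNReal.ofReal t
      = ∫⁻ x : ℝ, (Set.Icc c d).indicator (fun _ => ENNReal.ofReal t) x := by
        rw [lintegral_indicator_const measurableSet_Icc, Real.volume_Icc, mul_comm]
    _ ≤ ∫⁻ x : ℝ, volume {y : ℝ | !₂[x, y] ∈ S} := by
        refine lintegral_mono fun x => ?_
        by_cases hx : x ∈ Set.Icc c d
        · rw [Set.indicator_of_mem hx]
          calc ENNReal.ofReal t = volume (Set.Icc (l x) (l x + t)) := by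
                rw [Real.volume_Icc]; congr 1; ring
            _ ≤ _ := measure_mono fun y hy => h x hx y hy
        · rw [Set.indicator_of_notMem hx]; exact zero_le

lemma measurableSet_truncDisk (o : Plane) : MeasurableSet (truncDisk o) := by
  have h : IsClosed quadrant := by
    refine IsClosed.inter (s₁ := {p : Plane | 0 ≤ p 0}) (s₂ := {p : Plane | 0 ≤ p 1}) ?_ ?_
    all_goals exact isClosed_le continuous_const (by fun_prop)
  exact (Metric.isClosed_closedBall.inter h).measurableSet

lemma volume_truncDisk_le (o : Plane) : volume (truncDisk o) ≤ 4 := by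
  refine (measure_mono Set.inter_subset_left).trans ?_
  rw [disk, EuclideanSpace.volume_closedBall_fin_two]
  simpa using ENNReal.ofReal_le_ofReal Real.pi_le_four

/-- Seen from a point of the quadrant, the truncated disk contains a square of side `1/2`. -/
lemma le_volume_truncDisk {o : Plane} (ho : o ∈ quadrant) : 1 / 4 ≤ volume (truncDisk o) := by
  have h := le_volume_of_slices (measurableSet_truncDisk o) (c := o 0) (d := o 0 + 1 / 2)
    (t := 1 / 2) (fun _ => o 1) (by
      rintro x ⟨hx1, hx2⟩ y ⟨hy1, hy2⟩
      refine ⟨?_, ?_⟩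
      · rw [disk, Metric.mem_closedBall, dist_le_iff_sq _ _ zero_le_one]
        simp
        nlinarith
      · have := ho.1
        have := ho.2
        constructor <;> simp <;> linarith)
  refine le_trans (le_of_eq ?_) h
  rw [add_sub_cancel_left, ← ENNReal.ofReal_mul (by norm_num),
    show (1 / 4 : ENNReal) = ENNReal.ofReal (1 / 4) by
      rw [ENNReal.ofReal_div_of_pos (by norm_num)]; simp]
  norm_num

lemma uniformTruncDisk_apply (o : Plane) (S : Set Plane) :
    uniformTruncDisk o S = (volume (truncDisk o))⁻¹ * volume (truncDisk o ∩ S) :=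
  cond_apply (measurableSet_truncDisk o) _ _

lemma isProbabilityMeasure_uniformTruncDisk {o : Plane} (ho : o ∈ quadrant) :
    IsProbabilityMeasure (uniformTruncDisk o) := by
  refine cond_isProbabilityMeasure_of_finite ?_ ?_
  · exact (lt_of_lt_of_le (by norm_num) (le_volume_truncDisk ho)).ne'
  · exact (lt_of_le_of_lt (volume_truncDisk_le o) (by norm_num)).ne

lemma uniformTruncDisk_le {o : Plane} (ho : o ∈ quadrant) (S : Set Plane) :
    uniformTruncDisk o S ≤ 4 * volume (truncDisk o ∩ S) := by
  rw [uniformTruncDisk_apply]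
  gcongr
  rw [ENNReal.inv_le_iff_inv_le]
  simpa using le_volume_truncDisk ho

lemma le_uniformTruncDisk {o : Plane} {S : Set Plane} (hS : S ⊆ truncDisk o) :
    4⁻¹ * volume S ≤ uniformTruncDisk o S := by
  rw [uniformTruncDisk_apply, Set.inter_eq_self_of_subset_right hS]
  gcongr
  exact volume_truncDisk_le o

lemma uniformTruncDisk_le_ofReal {o : Plane} (ho : o ∈ quadrant) {S : Set Plane}
    (hS : MeasurableSet S) {c d t s : ℝ} (hcd : c ≤ d)
    (h0 : ∀ p ∈ S, p 0 ∈ Set.Icc c d)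
    (h1 : ∀ p ∈ S, ∀ q ∈ S, p 0 = q 0 → |p 1 - q 1| ≤ t) (hs : 4 * ((d - c) * t) ≤ s) :
    uniformTruncDisk o S ≤ ENNReal.ofReal s := by
  calc uniformTruncDisk o S ≤ 4 * volume (truncDisk o ∩ S) := uniformTruncDisk_le ho S
    _ ≤ 4 * volume S := by gcongr; exact Set.inter_subset_right
    _ ≤ ENNReal.ofReal 4 * (ENNReal.ofReal (d - c) * ENNReal.ofReal t) := by
        rw [ENNReal.ofReal_ofNat]
        gcongr
        exact volume_le_of_slices hS h0 h1
    _ = ENNReal.ofReal (4 * ((d - c) * t)) := by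
        rw [← ENNReal.ofReal_mul (by linarith), ← ENNReal.ofReal_mul (by norm_num)]
    _ ≤ ENNReal.ofReal s := ENNReal.ofReal_le_ofReal hs

lemma ofReal_le_uniformTruncDisk {o : Plane} {S : Set Plane} (hS : MeasurableSet S)
    (hSo : S ⊆ truncDisk o) {c d t s : ℝ} (hcd : c ≤ d) (l : ℝ → ℝ)
    (h : ∀ x ∈ Set.Icc c d, ∀ y ∈ Set.Icc (l x) (l x + t), !₂[x, y] ∈ S)
    (hs : s ≤ 4⁻¹ * ((d - c) * t)) :
    ENNReal.ofReal s ≤ uniformTruncDisk o S := by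
  calc ENNReal.ofReal s ≤ ENNReal.ofReal (4⁻¹ * ((d - c) * t)) := ENNReal.ofReal_le_ofReal hs
    _ = 4⁻¹ * (ENNReal.ofReal (d - c) * ENNReal.ofReal t) := by
        rw [ENNReal.ofReal_mul (by norm_num), ENNReal.ofReal_mul (by linarith),
          ENNReal.ofReal_inv_of_pos (by norm_num), ENNReal.ofReal_ofNat]
    _ ≤ 4⁻¹ * volume S := by gcongr; exact le_volume_of_slices hS l h
    _ ≤ uniformTruncDisk o S := le_uniformTruncDisk hSo

/-! ### Nearly antipodal pairs -/

/-- The pairs `(p, q)` with `p` to the right of `o`, `q` to the left of `o`, both at horizontal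
distance between `r / 2` and `r`, such that the vectors `p - o` and `o - q` have almost the same
slope: the two slopes differ by `O(r)`, which is expressed by a bound `r ^ 3` on the cross
product. -/
def nearAntipodal (o : Plane) (r : ℝ) : Set (Plane × Plane) :=
  {z | z.1 0 - o 0 ∈ Set.Icc (r / 2) r ∧ |z.1 1 - o 1| ≤ r / 2 ∧
    o 0 - z.2 0 ∈ Set.Icc (r / 2) r ∧
    |(o 1 - z.2 1) * (z.1 0 - o 0) - (z.1 1 - o 1) * (o 0 - z.2 0)| ≤ r ^ 3}

/-- The possible first components of nearly antipodal pairs. -/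
def frontBox (o : Plane) (r : ℝ) : Set Plane :=
  {p | p 0 - o 0 ∈ Set.Icc (r / 2) r ∧ |p 1 - o 1| ≤ r / 2}

/-- A box that holds the second components of nearly antipodal pairs. -/
def backBox (o : Plane) (r : ℝ) : Set Plane :=
  {q | o 0 - q 0 ∈ Set.Icc (r / 2) r ∧ |o 1 - q 1| ≤ 2 * r}

/-- The points that lie in neither of the unit disks around `p` and `q`. -/
def uncovered (p q : Plane) : Set Plane := {z | 1 < dist z p ∧ 1 < dist z q}

lemma measurableSet_nearAntipodal (o : Plane) (r : ℝ) : MeasurableSet (nearAntipodal o r) := by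
  simp only [nearAntipodal, Set.mem_Icc]
  measurability

lemma measurableSet_frontBox (o : Plane) (r : ℝ) : MeasurableSet (frontBox o r) := by
  simp only [frontBox, Set.mem_Icc]
  measurability

lemma measurableSet_uncovered (p q : Plane) : MeasurableSet (uncovered p q) := by
  unfold uncovered
  measurability

variable {o : Plane} {r : ℝ}

lemma fst_mem_frontBox {z : Plane × Plane} (h : z ∈ nearAntipodal o r) : z.1 ∈ frontBox o r :=
  ⟨h.1, h.2.1⟩

lemma snd_mem_backBox (hr : 0 < r) (hr1 : r ≤ 1 / 2) {z : Plane × Plane}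
    (h : z ∈ nearAntipodal o r) : z.2 ∈ backBox o r := by
  obtain ⟨⟨h1, h2⟩, h3, ⟨h4, h5⟩, h6⟩ := h
  refine ⟨⟨h4, h5⟩, ?_⟩
  set x := z.1 0 - o 0
  set y := z.1 1 - o 1
  set x' := o 0 - z.2 0
  set y' := o 1 - z.2 1
  have hx' : 0 ≤ x' := by linarith
  have hyx : |y * x'| ≤ r / 2 * r := by
    rw [abs_mul, abs_of_nonneg hx']
    gcongr
  have h7 : |y' * x| ≤ r ^ 3 + r / 2 * r := by
    calc |y' * x| = |(y' * x - y * x') + y * x'| := by ring_nf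
      _ ≤ _ := (abs_add_le _ _).trans (by gcongr)
  rw [abs_mul, abs_of_nonneg (by linarith : 0 ≤ x)] at h7
  have h8 : |y'| * (r / 2) ≤ |y'| * x := by gcongr
  have : r ^ 3 ≤ r * r * (1 / 2) := by nlinarith [mul_pos hr hr]
  by_contra! hc
  nlinarith

lemma dist_fst_le (hr : 0 < r) {z : Plane × Plane} (h : z ∈ nearAntipodal o r) :
    dist z.1 o ≤ 3 * r := by
  obtain ⟨⟨h1, h2⟩, h3⟩ := fst_mem_frontBox h
  rw [abs_le] at h3
  rw [dist_le_iff_sq _ _ (by linarith)]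
  nlinarith

lemma dist_snd_le (hr : 0 < r) (hr1 : r ≤ 1 / 2) {z : Plane × Plane}
    (h : z ∈ nearAntipodal o r) : dist z.2 o ≤ 3 * r := by
  obtain ⟨⟨h1, h2⟩, h3⟩ := snd_mem_backBox hr hr1 h
  rw [abs_le] at h3
  rw [dist_le_iff_sq _ _ (by linarith)]
  nlinarith

lemma uniform_frontBox_le (ho : o ∈ quadrant) (hr : 0 < r) :
    uniformTruncDisk o (frontBox o r) ≤ ENNReal.ofReal (2 * r ^ 2) := by
  refine uniformTruncDisk_le_ofReal ho (measurableSet_frontBox o r) (c := o 0 + r / 2)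
    (d := o 0 + r) (t := r) (by linarith) ?_ ?_ (by nlinarith)
  · rintro p ⟨⟨h1, h2⟩, -⟩
    constructor <;> linarith
  · rintro p ⟨-, h1⟩ q ⟨-, h2⟩ -
    rw [abs_le] at *
    constructor <;> linarith

lemma le_uniform_frontBox (hr : 0 < r) (hro : disk (3 * r) o ⊆ truncDisk o) :
    ENNReal.ofReal (r ^ 2 / 8) ≤ uniformTruncDisk o (frontBox o r) := by
  refine ofReal_le_uniformTruncDisk (measurableSet_frontBox o r) ?_ (c := o 0 + r / 2)
    (d := o 0 + r) (t := r) (by linarith) (fun _ => o 1 - r / 2) ?_ (by nlinarith)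
  · rintro p ⟨⟨h1, h2⟩, h3⟩
    refine hro ?_
    rw [abs_le] at h3
    rw [disk, Metric.mem_closedBall, dist_le_iff_sq _ _ (by linarith)]
    nlinarith
  · rintro x ⟨h1, h2⟩ y ⟨h3, h4⟩
    refine ⟨⟨?_, ?_⟩, abs_le.2 ⟨?_, ?_⟩⟩ <;> simp <;> linarith

/-- For fixed `p` and fixed first coordinate of `q`, the cross product is affine in the second
coordinate of `q` with slope at least `r / 2` in absolute value, so its bound `r ^ 3` leaves an
interval of length at most `4 * r ^ 2`. -/
lemma uniform_fiber_fst_le (ho : o ∈ quadrant) (hr : 0 < r) (p : Plane) :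
    uniformTruncDisk o (Prod.mk p ⁻¹' nearAntipodal o r) ≤ ENNReal.ofReal (8 * r ^ 3) := by
  refine uniformTruncDisk_le_ofReal ho (measurable_prodMk_left (measurableSet_nearAntipodal o r))
    (c := o 0 - r) (d := o 0 - r / 2) (t := 4 * r ^ 2) (by linarith) ?_ ?_ (by nlinarith)
  · rintro q ⟨-, -, ⟨h1, h2⟩, -⟩
    simp only at h1 h2
    constructor <;> linarith
  · rintro q ⟨⟨h0, -⟩, -, -, h1⟩ q' ⟨-, -, -, h2⟩ hq
    simp only at h0 h1 h2
    rw [← hq] at h2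
    have h3 : |(q 1 - q' 1) * (p 0 - o 0)| ≤ r ^ 3 + r ^ 3 := by
      refine le_trans (le_of_eq ?_) ((abs_sub _ _).trans (add_le_add h2 h1))
      ring_nf
    rw [abs_mul, abs_of_nonneg (by linarith : 0 ≤ p 0 - o 0)] at h3
    have h8 : |q 1 - q' 1| * (r / 2) ≤ |q 1 - q' 1| * (p 0 - o 0) := by gcongr
    by_contra! hc
    nlinarith

lemma uniform_fiber_snd_le (ho : o ∈ quadrant) (hr : 0 < r) (q : Plane) :
    uniformTruncDisk o ((fun p => (p, q)) ⁻¹' nearAntipodal o r) ≤ ENNReal.ofReal (8 * r ^ 3) := by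
  refine uniformTruncDisk_le_ofReal ho (measurable_prodMk_right (measurableSet_nearAntipodal o r))
    (c := o 0 + r / 2) (d := o 0 + r) (t := 4 * r ^ 2) (by linarith) ?_ ?_ (by nlinarith)
  · rintro p ⟨⟨h1, h2⟩, -⟩
    simp only at h1 h2
    constructor <;> linarith
  · rintro p ⟨-, -, ⟨h0, -⟩, h1⟩ p' ⟨-, -, -, h2⟩ hp
    simp only at h0 h1 h2
    rw [← hp] at h2
    have h3 : |(p 1 - p' 1) * (o 0 - q 0)| ≤ r ^ 3 + r ^ 3 := by
      refine le_trans (le_of_eq ?_) ((abs_sub _ _).trans (add_le_add h2 h1))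
      ring_nf
    rw [abs_mul, abs_of_nonneg (by linarith : 0 ≤ o 0 - q 0)] at h3
    have h8 : |p 1 - p' 1| * (r / 2) ≤ |p 1 - p' 1| * (o 0 - q 0) := by gcongr
    by_contra! hc
    nlinarith

lemma le_uniform_fiber_fst (hr : 0 < r) (hr1 : r ≤ 1 / 2) (hro : disk (3 * r) o ⊆ truncDisk o)
    {p : Plane} (hp : p ∈ frontBox o r) :
    ENNReal.ofReal (r ^ 3 / 4) ≤ uniformTruncDisk o (Prod.mk p ⁻¹' nearAntipodal o r) := by
  obtain ⟨⟨h1, h2⟩, h3⟩ := hp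
  have hx : 0 < p 0 - o 0 := by linarith
  refine ofReal_le_uniformTruncDisk (measurable_prodMk_left (measurableSet_nearAntipodal o r)) ?_
    (c := o 0 - r) (d := o 0 - r / 2) (t := 2 * r ^ 2) (by linarith)
    (fun x => o 1 - (p 1 - o 1) / (p 0 - o 0) * (o 0 - x) - r ^ 2) ?_ (by nlinarith)
  · intro q hq
    exact hro (dist_snd_le hr hr1 (z := (p, q)) hq)
  · rintro x ⟨h4, h5⟩ y ⟨h6, h7⟩
    refine ⟨⟨h1, h2⟩, h3, ⟨?_, ?_⟩, ?_⟩
    · simp; linarith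
    · simp; linarith
    · simp only [Matrix.cons_val_zero, Matrix.cons_val_one]
      have h8 : |o 1 - y - (p 1 - o 1) / (p 0 - o 0) * (o 0 - x)| ≤ r ^ 2 := by
        rw [abs_le]; constructor <;> linarith
      have h9 : (o 1 - y) * (p 0 - o 0) - (p 1 - o 1) * (o 0 - x) =
          (o 1 - y - (p 1 - o 1) / (p 0 - o 0) * (o 0 - x)) * (p 0 - o 0) := by
        field_simp
      rw [h9, abs_mul, abs_of_pos hx]
      calc _ ≤ r ^ 2 * r := by gcongr
        _ = r ^ 3 := by ring

/-! ### The area left uncovered by a nearly antipodal pair -/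

/-- A vector `v` of the unit disk that is farther than one from both `P = (x, y)` and
`-Q = -(x', y')`, where `P` and `Q` are almost parallel, is almost a unit vector and almost
orthogonal to `P`. -/
lemma almost_orthogonal_of_uncovered {x y x' y' v₁ v₂ : ℝ} (hr : 0 < r) (hx : r / 2 ≤ x)
    (hxr : x ≤ r) (hy : |y| ≤ r / 2) (hx' : r / 2 ≤ x') (hxr' : x' ≤ r) (hy' : |y'| ≤ 2 * r)
    (hxy : |y' * x - y * x'| ≤ r ^ 3) (hv : v₁ ^ 2 + v₂ ^ 2 ≤ 1)
    (hP : 1 < (v₁ - x) ^ 2 + (v₂ - y) ^ 2) (hQ : 1 < (v₁ + x') ^ 2 + (v₂ + y') ^ 2) :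
    |v₁ * x + v₂ * y| ≤ 9 * r ^ 2 ∧ 1 - 20 * r ^ 2 ≤ v₁ ^ 2 + v₂ ^ 2 := by
  have hy2 : y ^ 2 ≤ (r / 2) ^ 2 := sq_le_sq' (abs_le.1 hy).1 (abs_le.1 hy).2
  have hy2' : y' ^ 2 ≤ (2 * r) ^ 2 := sq_le_sq' (abs_le.1 hy').1 (abs_le.1 hy').2
  have hx2 : x ^ 2 ≤ r ^ 2 := by gcongr; linarith
  have hx2' : x' ^ 2 ≤ r ^ 2 := by gcongr; linarith
  have h1 : v₁ * x + v₂ * y ≤ 5 / 8 * r ^ 2 := by nlinarith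
  have h2 : -(5 / 2 * r ^ 2) ≤ v₁ * x' + v₂ * y' := by nlinarith
  have hv2 : |v₂| ≤ 1 := by rw [abs_le_one_iff_mul_self_le_one]; nlinarith [sq_nonneg v₁]
  have h3 : |v₂ * (y' * x - y * x')| ≤ r ^ 3 := by
    rw [abs_mul]
    nlinarith [abs_nonneg (y' * x - y * x')]
  have h4 : x' * (v₁ * x + v₂ * y) =
      x * (v₁ * x' + v₂ * y') - v₂ * (y' * x - y * x') := by ring
  have h5 : -(5 / 2 * r ^ 3) ≤ x * (v₁ * x' + v₂ * y') := by
    nlinarith [mul_le_mul_of_nonneg_left h2 (by linarith : 0 ≤ x),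
      mul_le_mul_of_nonneg_left hxr (sq_nonneg r)]
  have h6 : -(7 * r ^ 2) ≤ v₁ * x + v₂ * y := by
    by_contra! hc
    have h7 : -(7 / 2 * r ^ 3) ≤ x' * (v₁ * x + v₂ * y) := by
      rw [h4]; linarith [(abs_le.1 h3).2]
    nlinarith [mul_lt_mul_of_pos_left hc (by linarith : 0 < x'),
      mul_le_mul_of_nonneg_right hx' (sq_nonneg r)]
  refine ⟨abs_le.2 ⟨?_, ?_⟩, ?_⟩ <;> nlinarith [sq_nonneg r]

lemma half_le_abs_of_almost_orthogonal {x y v₁ v₂ : ℝ} (hr : 0 < r) (hr1 : r ≤ 1 / 200)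
    (hx : r / 2 ≤ x) (hy : |y| ≤ r / 2) (h1 : |v₁ * x + v₂ * y| ≤ 9 * r ^ 2)
    (h2 : 1 - 20 * r ^ 2 ≤ v₁ ^ 2 + v₂ ^ 2) : 1 / 2 ≤ |v₂| := by
  by_contra! hc
  have h3 : |v₁ * x| ≤ 9 * r ^ 2 + 1 / 2 * (r / 2) := by
    calc |v₁ * x| = |(v₁ * x + v₂ * y) - v₂ * y| := by ring_nf
      _ ≤ |v₁ * x + v₂ * y| + |v₂| * |y| := by rw [← abs_mul]; exact abs_sub _ _
      _ ≤ _ := by gcongr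
  rw [abs_mul, abs_of_nonneg (by linarith : 0 ≤ x)] at h3
  have h4 : |v₁| * (r / 2) ≤ |v₁| * x := by gcongr
  have h5 : |v₁| ≤ 3 / 5 := by
    by_contra! h
    nlinarith
  rw [← sq_abs v₁, ← sq_abs v₂] at h2
  nlinarith [abs_nonneg v₁, abs_nonneg v₂]

/-- In each half plane, the almost unit vectors almost orthogonal to `(x, y)` fill a region of
width `O(r)` and height `O(r ^ 2)`. -/
lemma almost_orthogonal_spread {x y v₁ v₂ u₁ u₂ : ℝ} (hr : 0 < r) (hr1 : r ≤ 1 / 200)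
    (hx : r / 2 ≤ x) (hy : |y| ≤ r / 2)
    (hv : |v₁ * x + v₂ * y| ≤ 9 * r ^ 2) (hu : |u₁ * x + u₂ * y| ≤ 9 * r ^ 2)
    (hv1 : 1 - 20 * r ^ 2 ≤ v₁ ^ 2 + v₂ ^ 2) (hv2 : v₁ ^ 2 + v₂ ^ 2 ≤ 1)
    (hu1 : 1 - 20 * r ^ 2 ≤ u₁ ^ 2 + u₂ ^ 2) (hu2 : u₁ ^ 2 + u₂ ^ 2 ≤ 1)
    (hv0 : 0 < v₂) (hu0 : 0 < u₂) :
    |v₁ - u₁| ≤ 296 * r ∧ (v₁ = u₁ → |v₂ - u₂| ≤ 20 * r ^ 2) := by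
  have hvh := half_le_abs_of_almost_orthogonal hr hr1 hx hy hv hv1
  have huh := half_le_abs_of_almost_orthogonal hr hr1 hx hy hu hu1
  rw [abs_of_pos hv0] at hvh
  rw [abs_of_pos hu0] at huh
  have hv2' : v₂ ≤ 1 := by nlinarith [sq_nonneg v₁]
  have hu2' : u₂ ≤ 1 := by nlinarith [sq_nonneg u₁]
  have hB : |(v₁ ^ 2 + v₂ ^ 2) - (u₁ ^ 2 + u₂ ^ 2)| ≤ 20 * r ^ 2 :=
    abs_le.2 ⟨by linarith, by linarith⟩
  have hA : |(v₁ * x + v₂ * y) - (u₁ * x + u₂ * y)| ≤ 18 * r ^ 2 :=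
    (abs_sub _ _).trans (by linarith)
  have hT : |(v₁ * x + v₂ * y) + (u₁ * x + u₂ * y)| ≤ 18 * r ^ 2 :=
    (abs_add_le _ _).trans (by linarith)
  -- The determinant of the linear system for `v - u` that is formed by its products with
  -- `(x, y)` and with `v + u`.
  set D := x * (v₂ + u₂) - y * (v₁ + u₁) with hD
  have hDr : r / 8 ≤ D := by
    have h1 : x * D = (x ^ 2 + y ^ 2) * (v₂ + u₂) -
        y * ((v₁ * x + v₂ * y) + (u₁ * x + u₂ * y)) := by rw [hD]; ring
    have h2 : |y * ((v₁ * x + v₂ * y) + (u₁ * x + u₂ * y))| ≤ r / 2 * (18 * r ^ 2) := by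
      rw [abs_mul]; gcongr
    have h3 : x * x ≤ (x ^ 2 + y ^ 2) * (v₂ + u₂) := by
      nlinarith [sq_nonneg x, sq_nonneg y]
    have h4 : x * x - 9 * r ^ 3 ≤ x * D := by
      rw [h1]; linarith [(abs_le.1 h2).2]
    by_contra! hc
    have h5 : x * D < x * (r / 8) := mul_lt_mul_of_pos_left hc (by linarith)
    have h6 : x * (3 / 4 * x) ≤ 9 * r ^ 3 := by nlinarith
    nlinarith [mul_pos hr hr]
  have hsol : (v₁ - u₁) * D = ((v₁ * x + v₂ * y) - (u₁ * x + u₂ * y)) * (v₂ + u₂) -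
      y * ((v₁ ^ 2 + v₂ ^ 2) - (u₁ ^ 2 + u₂ ^ 2)) := by rw [hD]; ring
  constructor
  · have h1 : |(v₁ - u₁) * D| ≤ 18 * r ^ 2 * 2 + r / 2 * (20 * r ^ 2) := by
      rw [hsol]
      refine (abs_sub _ _).trans ?_
      rw [abs_mul, abs_mul, abs_of_pos (by linarith : 0 < v₂ + u₂)]
      gcongr
      linarith
    rw [abs_mul, abs_of_nonneg (by linarith : 0 ≤ D)] at h1
    have h2 : |v₁ - u₁| * (r / 8) ≤ |v₁ - u₁| * D := by gcongr
    by_contra! hc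
    nlinarith [mul_pos hr hr]
  · rintro rfl
    have h1 : |(v₂ - u₂) * (v₂ + u₂)| ≤ 20 * r ^ 2 := by
      refine le_trans (le_of_eq ?_) hB
      ring_nf
    rw [abs_mul, abs_of_pos (by linarith : 0 < v₂ + u₂)] at h1
    nlinarith [abs_nonneg (v₂ - u₂)]

lemma uncovered_almost_orthogonal (hr : 0 < r) (hr1 : r ≤ 1 / 200) {z : Plane × Plane}
    (hz : z ∈ nearAntipodal o r) {v : Plane} (hv : v ∈ truncDisk o ∩ uncovered z.1 z.2) :
    |(v 0 - o 0) * (z.1 0 - o 0) + (v 1 - o 1) * (z.1 1 - o 1)| ≤ 9 * r ^ 2 ∧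
      1 - 20 * r ^ 2 ≤ (v 0 - o 0) ^ 2 + (v 1 - o 1) ^ 2 ∧
      (v 0 - o 0) ^ 2 + (v 1 - o 1) ^ 2 ≤ 1 := by
  obtain ⟨⟨hvo, -⟩, hp, hq⟩ := hv
  obtain ⟨-, hy'⟩ := snd_mem_backBox hr (by linarith) hz
  obtain ⟨⟨h1, h2⟩, h3, ⟨h4, h5⟩, h6⟩ := hz
  rw [disk, Metric.mem_closedBall, dist_le_iff_sq _ _ zero_le_one] at hvo
  rw [← not_le, dist_le_iff_sq _ _ zero_le_one, not_le] at hp hq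
  have h := almost_orthogonal_of_uncovered hr h1 h2 h3 h4 h5 hy' h6 (by linarith)
    (v₁ := v 0 - o 0) (v₂ := v 1 - o 1) (by ring_nf at hp ⊢; linarith)
    (by ring_nf at hq ⊢; linarith)
  exact ⟨h.1, h.2, by linarith⟩

lemma uniform_half_uncovered_le (ho : o ∈ quadrant) (hr : 0 < r) (hr1 : r ≤ 1 / 200)
    {z : Plane × Plane} (hz : z ∈ nearAntipodal o r) {ε : ℝ} (hε : ε = 1 ∨ ε = -1) :
    uniformTruncDisk o (truncDisk o ∩ uncovered z.1 z.2 ∩ {v | 0 < ε * (v 1 - o 1)}) ≤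
      ENNReal.ofReal (50000 * r ^ 3) := by
  set S := truncDisk o ∩ uncovered z.1 z.2 ∩ {v | 0 < ε * (v 1 - o 1)} with hS
  have hSm : MeasurableSet S :=
    ((measurableSet_truncDisk o).inter (measurableSet_uncovered _ _)).inter (by measurability)
  have hε2 : ε ^ 2 = 1 := by rcases hε with rfl | rfl <;> norm_num
  have hεa : |ε| = 1 := by rcases hε with rfl | rfl <;> norm_num
  -- For `ε = -1`, reflection in `o` reduces to the upper half plane.
  have key : ∀ v ∈ S, ∀ u ∈ S, |v 0 - u 0| ≤ 296 * r ∧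
      (v 0 = u 0 → |v 1 - u 1| ≤ 20 * r ^ 2) := by
    rintro v ⟨hv, hv0⟩ u ⟨hu, hu0⟩
    obtain ⟨a1, a2, a3⟩ := uncovered_almost_orthogonal hr hr1 hz hv
    obtain ⟨b1, b2, b3⟩ := uncovered_almost_orthogonal hr hr1 hz hu
    have h := almost_orthogonal_spread (v₁ := ε * (v 0 - o 0)) (v₂ := ε * (v 1 - o 1))
      (u₁ := ε * (u 0 - o 0)) (u₂ := ε * (u 1 - o 1)) hr hr1 hz.1.1 hz.2.1
      (by rw [mul_assoc, mul_assoc, ← mul_add, abs_mul, hεa, one_mul]; exact a1)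
      (by rw [mul_assoc, mul_assoc, ← mul_add, abs_mul, hεa, one_mul]; exact b1)
      (by rwa [mul_pow, mul_pow, hε2, one_mul, one_mul])
      (by rwa [mul_pow, mul_pow, hε2, one_mul, one_mul])
      (by rwa [mul_pow, mul_pow, hε2, one_mul, one_mul])
      (by rwa [mul_pow, mul_pow, hε2, one_mul, one_mul]) hv0 hu0
    rw [← mul_sub, ← mul_sub, abs_mul, abs_mul, hεa, one_mul, one_mul, sub_sub_sub_cancel_right,
      sub_sub_sub_cancel_right] at h
    exact ⟨h.1, fun h' => h.2 (by rw [h'])⟩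
  rcases S.eq_empty_or_nonempty with h | ⟨v, hv⟩
  · simp [h]
  · refine uniformTruncDisk_le_ofReal ho hSm (c := v 0 - 296 * r) (d := v 0 + 296 * r)
      (t := 20 * r ^ 2) (by linarith) (fun u hu => ?_) (fun u hu u' hu' h => (key u hu u' hu').2 h)
      (by nlinarith [pow_pos hr 3])
    have := abs_le.1 (key v hv u hu).1
    constructor <;> linarith

/-- The unit disks around a nearly antipodal pair leave only a region of area `O(r ^ 3)`
uncovered. -/
lemma uniform_uncovered_le (ho : o ∈ quadrant) (hr : 0 < r) (hr1 : r ≤ 1 / 200)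
    {z : Plane × Plane} (hz : z ∈ nearAntipodal o r) :
    uniformTruncDisk o (uncovered z.1 z.2) ≤ ENNReal.ofReal (100000 * r ^ 3) := by
  calc uniformTruncDisk o (uncovered z.1 z.2)
      = uniformTruncDisk o (truncDisk o ∩ uncovered z.1 z.2) := by
        rw [uniformTruncDisk_apply, uniformTruncDisk_apply, ← Set.inter_assoc, Set.inter_self]
    _ ≤ uniformTruncDisk o ((truncDisk o ∩ uncovered z.1 z.2 ∩ {v | 0 < 1 * (v 1 - o 1)}) ∪
          (truncDisk o ∩ uncovered z.1 z.2 ∩ {v | 0 < (-1) * (v 1 - o 1)})) := by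
        refine measure_mono fun v hv => ?_
        obtain ⟨a1, a2, -⟩ := uncovered_almost_orthogonal hr hr1 hz hv
        have h := half_le_abs_of_almost_orthogonal hr hr1 hz.1.1 hz.2.1 a1 a2
        rcases lt_trichotomy 0 (v 1 - o 1) with h0 | h0 | h0
        · exact Or.inl ⟨hv, by simpa using h0⟩
        · rw [← h0] at h; norm_num at h
        · exact Or.inr ⟨hv, by simpa using h0⟩
    _ ≤ ENNReal.ofReal (50000 * r ^ 3) + ENNReal.ofReal (50000 * r ^ 3) :=
        (measure_union_le _ _).trans (add_le_add
          (uniform_half_uncovered_le ho hr hr1 hz (Or.inl rfl))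
          (uniform_half_uncovered_le ho hr hr1 hz (Or.inr rfl)))
    _ = ENNReal.ofReal (100000 * r ^ 3) := by
        rw [← ENNReal.ofReal_add (by positivity) (by positivity)]; ring_nf

/-! ### Product measures and independent points -/

lemma prod_apply_le {α β : Type*} [MeasurableSpace α] [MeasurableSpace β] (μ : Measure α)
    (ν : Measure β) [SFinite ν] {Γ : Set (α × β)} (hΓ : MeasurableSet Γ) {A : Set α}
    (hA : MeasurableSet A) (h0 : ∀ z ∈ Γ, z.1 ∈ A) {h : ENNReal}
    (h1 : ∀ p ∈ A, ν (Prod.mk p ⁻¹' Γ) ≤ h) : (μ.prod ν) Γ ≤ h * μ A := by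
  rw [Measure.prod_apply hΓ, ← lintegral_indicator_const hA]
  refine lintegral_mono fun p => ?_
  by_cases hp : p ∈ A
  · rw [Set.indicator_of_mem hp]; exact h1 p hp
  · rw [Set.indicator_of_notMem hp]
    have : Prod.mk p ⁻¹' Γ = ∅ := Set.eq_empty_of_forall_notMem fun q hq => hp (h0 _ hq)
    simp [this]

lemma le_prod_apply {α β : Type*} [MeasurableSpace α] [MeasurableSpace β] (μ : Measure α)
    (ν : Measure β) [SFinite ν] {Γ : Set (α × β)} (hΓ : MeasurableSet Γ) {A : Set α}
    (hA : MeasurableSet A) {h : ENNReal} (h1 : ∀ p ∈ A, h ≤ ν (Prod.mk p ⁻¹' Γ)) :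
    h * μ A ≤ (μ.prod ν) Γ := by
  rw [Measure.prod_apply hΓ, ← lintegral_indicator_const hA]
  refine lintegral_mono fun p => ?_
  by_cases hp : p ∈ A
  · rw [Set.indicator_of_mem hp]; exact h1 p hp
  · rw [Set.indicator_of_notMem hp]; exact zero_le

section IndependentPoints

variable {ι α : Type*} [Fintype ι] [MeasurableSpace α] (μ : Measure α) [IsProbabilityMeasure μ]

lemma iIndepFun_eval : iIndepFun (fun (i : ι) (x : ι → α) => x i) (Measure.pi fun _ => μ) :=
  iIndepFun_pi (X := fun _ => id) fun _ => aemeasurable_id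

lemma map_pi_pair {i j : ι} (hij : i ≠ j) :
    (Measure.pi fun _ : ι => μ).map (fun x => (x i, x j)) = μ.prod μ := by
  rw [(indepFun_iff_map_prod_eq_prod_map_map (measurable_pi_apply i).aemeasurable
    (measurable_pi_apply j).aemeasurable).1 ((iIndepFun_eval μ).indepFun hij)]
  congr 1
  · exact (measurePreserving_eval (fun _ : ι => μ) i).map_eq
  · exact (measurePreserving_eval (fun _ : ι => μ) j).map_eq

lemma map_pi_triple {i j k : ι} (hij : i ≠ j) (hik : i ≠ k) (hjk : j ≠ k) :
    (Measure.pi fun _ : ι => μ).map (fun x => ((x i, x j), x k)) = (μ.prod μ).prod μ := by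
  rw [(indepFun_iff_map_prod_eq_prod_map_map (by fun_prop)
    (measurable_pi_apply k).aemeasurable).1
      ((iIndepFun_eval μ).indepFun_prodMk (by fun_prop) i j k hik hjk), map_pi_pair μ hij]
  congr 1
  exact (measurePreserving_eval (fun _ : ι => μ) k).map_eq

lemma pi_pair_real {i j : ι} (hij : i ≠ j) {Γ : Set (α × α)} (hΓ : MeasurableSet Γ) :
    (Measure.pi fun _ : ι => μ).real {x | (x i, x j) ∈ Γ} = (μ.prod μ).real Γ := by
  rw [← map_pi_pair μ hij, map_measureReal_apply (by fun_prop) hΓ]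
  rfl

lemma pi_pair_inter_pair_real {i j k l : ι} (hij : i ≠ j) (hkl : k ≠ l) (hik : i ≠ k)
    (hil : i ≠ l) (hjk : j ≠ k) (hjl : j ≠ l) {Γ : Set (α × α)} (hΓ : MeasurableSet Γ) :
    (Measure.pi fun _ : ι => μ).real ({x | (x i, x j) ∈ Γ} ∩ {x | (x k, x l) ∈ Γ}) =
      (μ.prod μ).real Γ ^ 2 := by
  have h := ((iIndepFun_eval (ι := ι) μ).indepFun_prodMk_prodMk (by fun_prop) i j k l hik hil hjk
    hjl).measure_inter_preimage_eq_mul Γ Γ hΓ hΓ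
  have h' := congrArg ENNReal.toReal h
  rw [ENNReal.toReal_mul] at h'
  rw [sq]
  nth_rewrite 1 [← pi_pair_real μ hij hΓ]
  rw [← pi_pair_real μ hkl hΓ]
  exact h'

lemma pi_triple_real_le {i j k : ι} (hij : i ≠ j) (hik : i ≠ k) (hjk : j ≠ k)
    {Γ : Set (α × α)} (hΓ : MeasurableSet Γ) {T : Set ((α × α) × α)} (hT : MeasurableSet T)
    (h0 : ∀ z ∈ T, z.1 ∈ Γ) {h : ℝ} (hh : 0 ≤ h)
    (h1 : ∀ z ∈ Γ, μ (Prod.mk z ⁻¹' T) ≤ ENNReal.ofReal h) :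
    (Measure.pi fun _ : ι => μ).real {x | ((x i, x j), x k) ∈ T} ≤ h * (μ.prod μ).real Γ := by
  have h2 : (Measure.pi fun _ : ι => μ).real {x | ((x i, x j), x k) ∈ T} =
      ((μ.prod μ).prod μ).real T := by
    rw [← map_pi_triple μ hij hik hjk, map_measureReal_apply (by fun_prop) hT]
    rfl
  rw [h2, Measure.real, Measure.real, ← ENNReal.toReal_ofReal hh, ← ENNReal.toReal_mul]
  refine ENNReal.toReal_mono (ENNReal.mul_ne_top ENNReal.ofReal_ne_top (measure_ne_top _ _)) ?_
  exact prod_apply_le _ _ hT hΓ h0 h1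

end IndependentPoints

/-! ### The second moment method -/

/-- Second moment method for a square array of events of equal probability `a`, any two of which
are independent if they share neither row nor column: bounds the probability that no event
occurs. -/
lemma second_moment_array {Ω : Type*} [MeasurableSpace Ω] (P : Measure Ω)
    [IsProbabilityMeasure P] {n : ℕ} (E : Fin n → Fin n → Set Ω)
    (hE : ∀ i j, MeasurableSet (E i j)) {a κ : ℝ} (hκ : 0 ≤ κ)
    (h1 : ∀ i j, P.real (E i j) = a)
    (h2 : ∀ i j k l, i ≠ k → j ≠ l → P.real (E i j ∩ E k l) = a ^ 2)
    (h3 : ∀ i j l, j ≠ l → P.real (E i j ∩ E i l) ≤ κ)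
    (h4 : ∀ i k j, i ≠ k → P.real (E i j ∩ E k j) ≤ κ) :
    P.real {ω | ∀ i j, ω ∉ E i j} * ((n : ℝ) ^ 2 * a) ^ 2 ≤
      (n : ℝ) ^ 2 * a + 2 * (n : ℝ) ^ 3 * κ := by
  set F : Fin n × Fin n → Set Ω := fun e => E e.1 e.2 with hF
  have hFm : ∀ e, MeasurableSet (F e) := fun e => hE _ _
  set G : Ω → ℝ := fun ω => ∑ e, (F e).indicator 1 ω with hG
  set m : ℝ := (n : ℝ) ^ 2 * a with hm
  have hIi : ∀ S : Set Ω, MeasurableSet S → Integrable (S.indicator (1 : Ω → ℝ)) P := fun S hS =>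
    (integrable_const (1 : ℝ)).indicator hS
  have hGi : Integrable G P := integrable_finsetSum _ fun e _ => hIi _ (hFm e)
  have hGm : ∫ ω, G ω ∂P = m := by
    rw [integral_finsetSum _ fun e _ => hIi _ (hFm e)]
    have h : ∀ e, ∫ ω, (F e).indicator (1 : Ω → ℝ) ω ∂P = a := fun e =>
      (integral_indicator_one (hFm e)).trans (h1 _ _)
    simp [h, hm, sq]
  have hG2 : ∀ ω, G ω ^ 2 = ∑ e, ∑ f, (F e ∩ F f).indicator 1 ω := by
    intro ω
    rw [sq, hG, Finset.sum_mul_sum]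
    refine Finset.sum_congr rfl fun e _ => Finset.sum_congr rfl fun f _ => ?_
    rw [Set.inter_indicator_one]; rfl
  have hG2i : Integrable (fun ω => G ω ^ 2) P := by
    simp only [hG2]
    exact integrable_finsetSum _ fun e _ => integrable_finsetSum _ fun f _ =>
      hIi _ ((hFm e).inter (hFm f))
  have ha : ∀ _ : Fin n, 0 ≤ a := fun i => by rw [← h1 i i]; exact measureReal_nonneg
  have hG2m : ∫ ω, G ω ^ 2 ∂P ≤ m ^ 2 + (m + 2 * (n : ℝ) ^ 3 * κ) := by
    let δ : Fin n → Fin n → ℝ := fun i k => if i = k then κ else 0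
    have hδ : ∀ i, ∑ k, δ i k = κ := fun i => by simp [δ]
    simp only [hG2]
    rw [integral_finsetSum _ fun e _ => integrable_finsetSum _ fun f _ =>
      hIi _ ((hFm e).inter (hFm f))]
    calc ∑ e, ∫ ω, ∑ f, (F e ∩ F f).indicator (1 : Ω → ℝ) ω ∂P
        = ∑ e, ∑ f, P.real (F e ∩ F f) := by
          refine Finset.sum_congr rfl fun e _ => ?_
          rw [integral_finsetSum _ fun f _ => hIi _ ((hFm e).inter (hFm f))]
          exact Finset.sum_congr rfl fun f _ => integral_indicator_one ((hFm e).inter (hFm f))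
      _ ≤ ∑ e : Fin n × Fin n, ∑ f : Fin n × Fin n, (a ^ 2 + ((if e = f then a else 0) +
            (δ e.1 f.1 + δ e.2 f.2))) := by
          refine Finset.sum_le_sum fun e _ => Finset.sum_le_sum fun f _ => ?_
          obtain ⟨i, j⟩ := e
          obtain ⟨k, l⟩ := f
          have ha0 := ha i
          by_cases hik : i = k <;> by_cases hjl : j = l
          · subst hik hjl
            simp only [hF, δ, Set.inter_self, h1, if_true]
            nlinarith
          · subst hik
            simp only [hF, δ, Prod.mk.injEq, hjl, and_false, if_true, if_false]
            nlinarith [h3 i j l hjl]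
          · subst hjl
            simp only [hF, δ, Prod.mk.injEq, hik, false_and, if_true, if_false]
            nlinarith [h4 i k j hik]
          · simp [hF, δ, hik, hjl, h2 i j k l hik hjl]
      _ = m ^ 2 + (m + 2 * (n : ℝ) ^ 3 * κ) := by
          have h5 : ∀ e : Fin n × Fin n, ∑ f : Fin n × Fin n, δ e.1 f.1 = n * κ := fun e => by
            simp [Fintype.sum_prod_type, ← Finset.mul_sum, hδ]
          have h6 : ∀ e : Fin n × Fin n, ∑ f : Fin n × Fin n, δ e.2 f.2 = n * κ := fun e => by
            simp [Fintype.sum_prod_type, hδ]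
          simp only [Finset.sum_add_distrib, h5, h6]
          simp [hm]
          ring
  have hvar : ∫ ω, (G ω - m) ^ 2 ∂P ≤ m + 2 * (n : ℝ) ^ 3 * κ := by
    have : ∀ ω, (G ω - m) ^ 2 = G ω ^ 2 - 2 * m * G ω + m ^ 2 := fun ω => by ring
    simp only [this]
    rw [integral_add (f := fun ω => G ω ^ 2 - 2 * m * G ω) (hG2i.sub (hGi.const_mul _))
      (integrable_const _), integral_sub hG2i (hGi.const_mul _), integral_const_mul, hGm]
    simp
    linarith
  refine le_trans ?_ hvar
  have hN : MeasurableSet {ω | ∀ i j, ω ∉ E i j} := by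
    simp only [Set.ofPred_forall]
    exact MeasurableSet.iInter fun i => MeasurableSet.iInter fun j => (hE i j).compl
  rw [← smul_eq_mul, ← integral_indicator_const _ hN]
  refine integral_mono ((integrable_const _).indicator hN) ?_ fun ω => ?_
  · have : (fun ω => (G ω - m) ^ 2) = fun ω => G ω ^ 2 - 2 * m * G ω + m ^ 2 := by
      ext ω; ring
    rw [this]
    exact (hG2i.sub (hGi.const_mul _)).add (integrable_const _)
  · by_cases hω : ω ∈ {ω | ∀ i j, ω ∉ E i j}
    · have : G ω = 0 := Finset.sum_eq_zero fun e _ => Set.indicator_of_notMem (hω _ _) _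
      simp [Set.indicator_of_mem hω, this]
    · rw [Set.indicator_of_notMem hω]
      exact sq_nonneg _

/-! ### Existence of a dominating pair -/

lemma prod_nearAntipodal_le (ho : o ∈ quadrant) (hr : 0 < r) :
    ((uniformTruncDisk o).prod (uniformTruncDisk o)).real (nearAntipodal o r) ≤ 16 * r ^ 5 := by
  have := isProbabilityMeasure_uniformTruncDisk ho
  refine ENNReal.toReal_le_of_le_ofReal (by positivity) ?_
  calc _ ≤ ENNReal.ofReal (8 * r ^ 3) * uniformTruncDisk o (frontBox o r) :=
        prod_apply_le _ _ (measurableSet_nearAntipodal o r) (measurableSet_frontBox o r)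
          (fun _ => fst_mem_frontBox) fun p _ => uniform_fiber_fst_le ho hr p
    _ ≤ ENNReal.ofReal (8 * r ^ 3) * ENNReal.ofReal (2 * r ^ 2) := by
        gcongr; exact uniform_frontBox_le ho hr
    _ = ENNReal.ofReal (16 * r ^ 5) := by
        rw [← ENNReal.ofReal_mul (by positivity)]; ring_nf

lemma le_prod_nearAntipodal (ho : o ∈ quadrant) (hr : 0 < r) (hr1 : r ≤ 1 / 2)
    (hro : disk (3 * r) o ⊆ truncDisk o) :
    r ^ 5 / 32 ≤
      ((uniformTruncDisk o).prod (uniformTruncDisk o)).real (nearAntipodal o r) := by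
  have := isProbabilityMeasure_uniformTruncDisk ho
  rw [Measure.real, ← ENNReal.ofReal_le_iff_le_toReal (measure_ne_top _ _)]
  calc ENNReal.ofReal (r ^ 5 / 32)
      = ENNReal.ofReal (r ^ 3 / 4) * ENNReal.ofReal (r ^ 2 / 8) := by
        rw [← ENNReal.ofReal_mul (by positivity)]; ring_nf
    _ ≤ ENNReal.ofReal (r ^ 3 / 4) * uniformTruncDisk o (frontBox o r) := by
        gcongr; exact le_uniform_frontBox hr hro
    _ ≤ _ := le_prod_apply _ _ (measurableSet_nearAntipodal o r) (measurableSet_frontBox o r)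
          fun p hp => le_uniform_fiber_fst hr hr1 hro hp

/-- With high probability, there is a nearly antipodal pair among `2 * n` independent points. -/
lemma no_nearAntipodal_pair_le {ι : Type*} [Fintype ι] (ho : o ∈ quadrant) (hr : 0 < r)
    (hr1 : r ≤ 1 / 2) (hro : disk (3 * r) o ⊆ truncDisk o) {n : ℕ} (hn : 0 < n)
    (α β : Fin n → ι) (hα : α.Injective) (hβ : β.Injective) (hαβ : ∀ i j, α i ≠ β j) :
    (Measure.pi fun _ : ι => uniformTruncDisk o).real
        {x | ∀ i j, (x (α i), x (β j)) ∉ nearAntipodal o r} ≤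
      32 * (1 + 16 * n * r ^ 3) / (n ^ 2 * r ^ 5) := by
  have := isProbabilityMeasure_uniformTruncDisk ho
  set μ := uniformTruncDisk o
  set Γ := nearAntipodal o r
  have hΓ : MeasurableSet Γ := measurableSet_nearAntipodal o r
  set a := (μ.prod μ).real Γ with ha
  have ha1 : r ^ 5 / 32 ≤ a := le_prod_nearAntipodal ho hr hr1 hro
  have ha0 : 0 < a := lt_of_lt_of_le (by positivity) ha1
  have h := second_moment_array (Measure.pi fun _ : ι => μ)
    (fun i j => {x | (x (α i), x (β j)) ∈ Γ})
    (fun i j => (show Measurable fun x : ι → Plane => (x (α i), x (β j)) by fun_prop) hΓ)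
    (a := a) (κ := 8 * r ^ 3 * a) (by positivity)
    (fun i j => pi_pair_real μ (hαβ i j) hΓ)
    (fun i j k l hik hjl => pi_pair_inter_pair_real μ (hαβ i j) (hαβ k l) (hα.ne hik) (hαβ i l)
      (hαβ k j).symm (hβ.ne hjl) hΓ)
    -- Two pairs that share a point cost a further factor `O(r ^ 3)`.
    (fun i j l hjl => pi_triple_real_le μ (hαβ i j) (hαβ i l) (hβ.ne hjl) hΓ
      (T := {z | z.1 ∈ Γ ∧ (z.1.1, z.2) ∈ Γ})
      ((measurable_fst hΓ).inter ((show Measurable fun z : (Plane × Plane) × Plane =>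
        (z.1.1, z.2) by fun_prop) hΓ))
      (fun z hz => hz.1) (by positivity)
      (fun z _ => (measure_mono fun q hq => hq.2).trans (uniform_fiber_fst_le ho hr z.1)))
    (fun i k j hik => by
      refine pi_triple_real_le μ (hαβ i j) (hα.ne hik) (hαβ k j).symm hΓ
        (T := {z | z.1 ∈ Γ ∧ (z.2, z.1.2) ∈ Γ})
        ((measurable_fst hΓ).inter ((show Measurable fun z : (Plane × Plane) × Plane =>
          (z.2, z.1.2) by fun_prop) hΓ))
        (fun z hz => hz.1) (by positivity)
        (fun z _ => (measure_mono fun q hq => hq.2).trans (uniform_fiber_snd_le ho hr z.2)))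
  simp only [Set.mem_ofPred_eq] at h
  set p := (Measure.pi fun _ : ι => μ).real {x | ∀ i j, (x (α i), x (β j)) ∉ Γ}
  have hn' : (0 : ℝ) < n := by exact_mod_cast hn
  have h2 : p * (n ^ 2 * a) ≤ 1 + 16 * n * r ^ 3 := by
    refine le_of_mul_le_mul_right ?_ (show 0 < (n : ℝ) ^ 2 * a by positivity)
    calc _ = p * (n ^ 2 * a) ^ 2 := by ring
      _ ≤ _ := h
      _ = _ := by ring
  rw [le_div_iff₀ (by positivity)]
  have h3 : p * (n ^ 2 * (r ^ 5 / 32)) ≤ p * (n ^ 2 * a) := by gcongr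
  linarith

/-- Two nearly antipodal points that leave no other point uncovered form a connected dominating
set. -/
lemma mem_localCDSEvent {w b : ℕ} (hr : 0 < r) (hr1 : r ≤ 1 / 6) (hrd : 3 * r ≤ delta b)
    {x : Vertex w b → Plane} {i j : Fin b} (hij : i ≠ j)
    (hx : (x (Sum.inr i), x (Sum.inr j)) ∈ nearAntipodal o r)
    (hc : ∀ v, v ≠ Sum.inr i → v ≠ Sum.inr j →
      x v ∉ uncovered (x (Sum.inr i)) (x (Sum.inr j))) :
    x ∈ localCDSEvent w b o := by
  have hi := dist_fst_le hr hx
  have hj := dist_snd_le hr (by linarith) hx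
  have hne : (Sum.inr i : Vertex w b) ≠ Sum.inr j := fun h => hij (Sum.inr_injective h)
  have hadj : (unitDiskGraph x).Adj (Sum.inr i) (Sum.inr j) := by
    refine ⟨hne, (dist_triangle_right _ _ o).trans ?_⟩
    simp only at hi hj
    linarith
  refine ⟨i, j, hadj, hi.trans hrd, hj.trans hrd, fun v => ?_, ?_⟩
  · by_cases hvi : v = Sum.inr i
    · exact Or.inl (Or.inl hvi)
    by_cases hvj : v = Sum.inr j
    · exact Or.inl (Or.inr hvj)
    have h := hc v hvi hvj
    simp only [uncovered, Set.mem_ofPred_eq, not_and_or, not_lt] at h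
    exact h.elim (fun h => Or.inr ⟨_, Or.inl rfl, hvi, h⟩) fun h => Or.inr ⟨_, Or.inr rfl, hvj, h⟩
  · exact SimpleGraph.induce_pair_connected_of_adj hadj

lemma uncovered_point_le {ι : Type*} [Fintype ι] (ho : o ∈ quadrant) (hr : 0 < r)
    (hr1 : r ≤ 1 / 200) {i j k : ι} (hij : i ≠ j) (hik : i ≠ k) (hjk : j ≠ k) :
    (Measure.pi fun _ : ι => uniformTruncDisk o).real
        {x | (x i, x j) ∈ nearAntipodal o r ∧ x k ∈ uncovered (x i) (x j)} ≤
      1600000 * r ^ 8 := by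
  have := isProbabilityMeasure_uniformTruncDisk ho
  have hT : MeasurableSet {z : (Plane × Plane) × Plane |
      z.1 ∈ nearAntipodal o r ∧ z.2 ∈ uncovered z.1.1 z.1.2} := by
    refine (measurable_fst (measurableSet_nearAntipodal o r)).inter ?_
    exact (measurableSet_lt measurable_const
      (show Measurable fun z : (Plane × Plane) × Plane => dist z.2 z.1.1 by fun_prop)).inter
      (measurableSet_lt measurable_const
        (show Measurable fun z : (Plane × Plane) × Plane => dist z.2 z.1.2 by fun_prop))
  calc _ ≤ 100000 * r ^ 3 *
        ((uniformTruncDisk o).prod (uniformTruncDisk o)).real (nearAntipodal o r) :=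
        pi_triple_real_le (uniformTruncDisk o) hij hik hjk (measurableSet_nearAntipodal o r) hT
          (fun z hz => hz.1) (by positivity) fun z hz =>
            (measure_mono fun v hv => hv.2).trans (uniform_uncovered_le ho hr hr1 hz)
    _ ≤ 100000 * r ^ 3 * (16 * r ^ 5) := by gcongr; exact prod_nearAntipodal_le ho hr
    _ = 1600000 * r ^ 8 := by ring

lemma one_sub_law_localCDSEvent_le {w b n : ℕ} (hn : 0 < n) (hnb : 2 * n ≤ b)
    (ho : o ∈ quadrant) (hr : 0 < r) (hr1 : r ≤ 1 / 200)
    (hro : disk (3 * r) o ⊆ truncDisk o) (hrd : 3 * r ≤ delta b) :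
    1 - (law w b o).real (localCDSEvent w b o) ≤
      32 * (1 + 16 * n * r ^ 3) / (n ^ 2 * r ^ 5) +
        n ^ 2 * (w + b) * (1600000 * r ^ 8) := by
  have := isProbabilityMeasure_uniformTruncDisk ho
  unfold law
  set P := Measure.pi fun _ : Vertex w b => uniformTruncDisk o
  let f : Fin n → Fin b := fun i => ⟨i, by omega⟩
  let g : Fin n → Fin b := fun i => ⟨n + i, by omega⟩
  have hf : f.Injective := fun i j h => Fin.ext (by simpa [f] using h)
  have hg : g.Injective := fun i j h => Fin.ext (by simpa [g] using h)
  have hfg : ∀ i j, f i ≠ g j := fun i j h => by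
    have := congrArg Fin.val h
    simp only [f, g] at this
    omega
  let α : Fin n → Vertex w b := fun i => Sum.inr (f i)
  let β : Fin n → Vertex w b := fun i => Sum.inr (g i)
  have hαβ : ∀ i j, α i ≠ β j := fun i j h => hfg i j (Sum.inr_injective h)
  set N := {x : Vertex w b → Plane | ∀ i j, (x (α i), x (β j)) ∉ nearAntipodal o r}
  let U : Fin n × Fin n × Vertex w b → Set (Vertex w b → Plane) := fun e =>
    {x | α e.1 ≠ e.2.2 ∧ β e.2.1 ≠ e.2.2 ∧ (x (α e.1), x (β e.2.1)) ∈ nearAntipodal o r ∧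
      x e.2.2 ∈ uncovered (x (α e.1)) (x (β e.2.1))}
  have hU : ∀ e, P.real (U e) ≤ 1600000 * r ^ 8 := by
    rintro ⟨i, j, k⟩
    by_cases h : α i ≠ k ∧ β j ≠ k
    · refine le_trans (measureReal_mono fun x hx => hx.2.2) ?_
      exact uncovered_point_le ho hr hr1 (hαβ i j) h.1 h.2
    · have : U (i, j, k) = ∅ := Set.eq_empty_of_forall_notMem fun x hx => h ⟨hx.1, hx.2.1⟩
      rw [this]
      simp
      positivity
  have hcover : (Set.univ : Set (Vertex w b → Plane)) ⊆
      localCDSEvent w b o ∪ (N ∪ ⋃ e, U e) := by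
    intro x _
    by_contra hx
    simp only [Set.mem_union, not_or, Set.mem_iUnion, not_exists] at hx
    obtain ⟨h1, h2, h3⟩ := hx
    apply h2
    intro i j hij
    refine h1 (mem_localCDSEvent hr (by linarith) hrd (hfg i j) hij fun v hv1 hv2 hv => ?_)
    exact h3 (i, j, v) ⟨hv1.symm, hv2.symm, hij, hv⟩
  have h1 : 1 ≤ P.real (localCDSEvent w b o) + (P.real N + ∑ e, P.real (U e)) := by
    calc (1 : ℝ) = P.real Set.univ := probReal_univ.symm
      _ ≤ P.real (localCDSEvent w b o ∪ (N ∪ ⋃ e, U e)) := measureReal_mono hcover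
      _ ≤ _ := (measureReal_union_le _ _).trans (add_le_add le_rfl
          ((measureReal_union_le _ _).trans (add_le_add le_rfl (measureReal_iUnion_fintype_le _))))
  have h2 : ∑ e, P.real (U e) ≤ n ^ 2 * (w + b) * (1600000 * r ^ 8) := by
    refine (Finset.sum_le_sum fun e _ => hU e).trans (le_of_eq ?_)
    simp only [Finset.sum_const, Finset.card_univ, Fintype.card_prod, Fintype.card_sum,
      Fintype.card_fin, nsmul_eq_mul]
    push_cast
    ring
  have h3 := no_nearAntipodal_pair_le ho hr (by linarith) hro hn α β
    (Sum.inr_injective.comp hf) (Sum.inr_injective.comp hg) hαβ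
  linarith

/-! ### Choice of the scale -/

open Filter in
lemma eventually_log_bounds :
    ∀ᶠ b : ℕ in atTop, 3 ≤ b ∧ 1 ≤ Real.log b ∧ 200 ≤ (b : ℝ) ^ (5 / 13 : ℝ) ∧
      3 * ((b : ℝ) ^ (1 / 3 : ℝ) * Real.log b) ≤ (b : ℝ) ^ (5 / 13 : ℝ) ∧
      Real.log b ^ (3 : ℝ) ≤ (b : ℝ) ^ (1 / 13 : ℝ) := by
  have hc : Tendsto (fun b : ℕ => (b : ℝ)) atTop atTop := tendsto_natCast_atTop_atTop
  have h1 := (Real.tendsto_log_atTop.comp hc).eventually_ge_atTop 1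
  have h2 := ((tendsto_rpow_atTop (by norm_num : (0 : ℝ) < 5 / 13)).comp hc).eventually_ge_atTop 200
  have h3 := hc.eventually ((isLittleO_log_rpow_rpow_atTop 1
    (by norm_num : (0 : ℝ) < 2 / 39)).bound (by norm_num : (0 : ℝ) < 1 / 3))
  have h4 := hc.eventually ((isLittleO_log_rpow_rpow_atTop 3
    (by norm_num : (0 : ℝ) < 1 / 13)).bound (by norm_num : (0 : ℝ) < 1))
  filter_upwards [eventually_ge_atTop 3, h1, h2, h3, h4] with b hb h1 h2 h3 h4
  have hb0 : (0 : ℝ) < b := by positivity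
  simp only [Function.comp_apply] at h1 h2
  refine ⟨hb, h1, h2, ?_, ?_⟩
  · rw [Real.rpow_one, Real.norm_of_nonneg (by linarith), Real.norm_of_nonneg (by positivity)] at h3
    have h5 : (b : ℝ) ^ (5 / 13 : ℝ) = (b : ℝ) ^ (1 / 3 : ℝ) * (b : ℝ) ^ (2 / 39 : ℝ) := by
      rw [← Real.rpow_add hb0]; norm_num
    rw [h5, mul_left_comm]
    gcongr
    linarith
  · rwa [Real.norm_of_nonneg (by positivity), Real.norm_of_nonneg (by positivity), one_mul] at h4

/-- The failure probability for the radius `r = b ^ (-5 / 13)`, where the exponent balances the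
two error terms. -/
lemma failure_bound {w b n : ℕ} {L r : ℝ} (hn3 : b ≤ 3 * n) (hnb : n ≤ b) (hb : 0 < b)
    (hL : 1 ≤ L) (hw : (w : ℝ) ≤ b * L) {β : ℝ} (hβ : 1 ≤ β) (hbβ : (b : ℝ) = β ^ 13)
    (hr : r = (β ^ 5)⁻¹) :
    32 * (1 + 16 * n * r ^ 3) / (n ^ 2 * r ^ 5) + n ^ 2 * (w + b) * (1600000 * r ^ 8) ≤
      4000000 * L / β := by
  have hβ0 : 0 < β := by linarith
  have hn3' : (b : ℝ) ≤ 3 * n := by exact_mod_cast hn3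
  have hnb' : (n : ℝ) ≤ b := by exact_mod_cast hnb
  have hb' : (0 : ℝ) < b := by exact_mod_cast hb
  have hn' : (0 : ℝ) < n := by linarith
  have h1 : n * r ^ 3 ≤ 1 := by
    calc n * r ^ 3 ≤ β ^ 13 * r ^ 3 := by rw [← hbβ]; gcongr; rw [hr]; positivity
      _ = (β ^ 2)⁻¹ := by rw [hr]; field_simp
      _ ≤ 1 := inv_le_one_of_one_le₀ (one_le_pow₀ hβ)
  have h2 : β / 9 ≤ n ^ 2 * r ^ 5 := by
    calc β / 9 = (b / 3) ^ 2 * r ^ 5 := by rw [hbβ, hr]; field_simp; norm_num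
      _ ≤ n ^ 2 * r ^ 5 := by
        gcongr
        · rw [hr]; positivity
        · linarith
  have h3 : 32 * (1 + 16 * n * r ^ 3) / (n ^ 2 * r ^ 5) ≤ 32 * 17 / (β / 9) := by
    gcongr
    linarith
  have h4 : n ^ 2 * (w + b) * (1600000 * r ^ 8) ≤ 3200000 * L / β := by
    calc n ^ 2 * (w + b) * (1600000 * r ^ 8)
        ≤ (b : ℝ) ^ 2 * (2 * (b * L)) * (1600000 * r ^ 8) := by
          have : 0 ≤ r := by rw [hr]; positivity
          gcongr
          nlinarith
      _ = 3200000 * L / β := by rw [hbβ, hr]; field_simp; norm_num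
  calc _ ≤ 32 * 17 / (β / 9) + 3200000 * L / β := add_le_add h3 h4
    _ = (4896 + 3200000 * L) / β := by field_simp; norm_num
    _ ≤ 4000000 * L / β := by gcongr; linarith

lemma law_localCDSEvent_ge {w b : ℕ} (hb : 3 ≤ b) (hL : 1 ≤ Real.log b)
    (h200 : 200 ≤ (b : ℝ) ^ (5 / 13 : ℝ))
    (hδ : 3 * ((b : ℝ) ^ (1 / 3 : ℝ) * Real.log b) ≤ (b : ℝ) ^ (5 / 13 : ℝ))
    (hβ : Real.log b ^ (3 : ℝ) ≤ (b : ℝ) ^ (1 / 13 : ℝ))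
    (hw : (w : ℝ) < (b : ℝ) * Real.log b ^ (3 / 2 : ℝ)) {o : Plane}
    (ho : disk (delta b) o ⊆ quadrant) :
    1 - 4000000 / Real.log b ^ (3 / 2 : ℝ) ≤ (law w b o).real (localCDSEvent w b o) := by
  have hb0 : (0 : ℝ) < b := by positivity
  have hL0 : 0 < Real.log b := by linarith
  set β := (b : ℝ) ^ (1 / 13 : ℝ) with hβdef
  set L := Real.log b ^ (3 / 2 : ℝ) with hLdef
  have hβ1 : 1 ≤ β := Real.one_le_rpow (by exact_mod_cast (by omega : 1 ≤ b)) (by norm_num)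
  have hL1 : 1 ≤ L := Real.one_le_rpow hL (by norm_num)
  have hβ5 : (b : ℝ) ^ (5 / 13 : ℝ) = β ^ 5 := by
    rw [hβdef, ← Real.rpow_mul_natCast hb0.le]; norm_num
  have hβ13 : (b : ℝ) = β ^ 13 := by
    rw [hβdef, ← Real.rpow_mul_natCast hb0.le]; norm_num
  have hLL : L * L ≤ β := by
    refine le_trans (le_of_eq ?_) hβ
    rw [hLdef, ← Real.rpow_add hL0]; norm_num
  rw [hβ5] at h200 hδ
  set r := (β ^ 5)⁻¹ with hr
  have hr0 : 0 < r := by positivity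
  have hr1 : r ≤ 1 / 200 := by
    rw [hr, one_div]; exact inv_anti₀ (by norm_num) h200
  have hrd : 3 * r ≤ delta b := by
    rw [delta, hr, ← div_eq_mul_inv, div_le_div_iff₀ (by positivity) (by positivity)]
    linarith
  have hro : disk (3 * r) o ⊆ truncDisk o := Set.subset_inter
    (Metric.closedBall_subset_closedBall (by linarith))
    ((Metric.closedBall_subset_closedBall hrd).trans ho)
  have hoq : o ∈ quadrant := ho (Metric.mem_closedBall_self (by linarith))
  have h1 := one_sub_law_localCDSEvent_le (w := w) (b := b) (n := b / 2) (by omega) (by omega)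
    hoq hr0 hr1 hro hrd
  have h2 := failure_bound (w := w) (b := b) (n := b / 2) (by omega) (by omega) (by omega)
    hL1 hw.le hβ1 hβ13 hr
  have h3 : 4000000 * L / β ≤ 4000000 / L := by
    rw [div_le_div_iff₀ (by linarith) (by linarith)]
    linarith
  linarith

end UnitDisk

theorem theorem4 :
    ∃ c : ℝ, 0 < c ∧
      ∀ (w b : ℕ), 0 < w → 0 < b →
        (w : ℝ) < (b : ℝ) * Real.log b ^ (3 / 2 : ℝ) →
        ∀ o : UnitDisk.Plane,
          UnitDisk.disk (UnitDisk.delta b) o ⊆ UnitDisk.quadrant →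
          1 - c / Real.log b ^ (3 / 2 : ℝ) ≤
            (UnitDisk.law w b o).real (UnitDisk.localCDSEvent w b o) := by
  obtain ⟨B, hB⟩ := Filter.eventually_atTop.1 UnitDisk.eventually_log_bounds
  refine ⟨max 4000000 (Real.log B ^ (3 / 2 : ℝ)), by positivity, fun w b hw hb hwb o ho => ?_⟩
  -- The hypothesis on `w` excludes `b = 1`, for which the logarithm vanishes.
  have hL : 0 < Real.log b ^ (3 / 2 : ℝ) := by
    have h : 0 < (b : ℝ) * Real.log b ^ (3 / 2 : ℝ) := lt_of_le_of_lt (Nat.cast_nonneg w) hwb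
    exact pos_of_mul_pos_right h (Nat.cast_nonneg b)
  rcases le_total B b with hBb | hBb
  · obtain ⟨h1, h2, h3, h4, h5⟩ := hB b hBb
    refine le_trans ?_ (UnitDisk.law_localCDSEvent_ge h1 h2 h3 h4 h5 hwb ho)
    gcongr
    exact le_max_left _ _
  -- For small `b` the claimed lower bound is not positive.
  · refine le_trans ?_ measureReal_nonneg
    rw [sub_nonpos, one_le_div hL]
    refine le_trans ?_ (le_max_right _ _)
    have hb1 : (1 : ℝ) ≤ b := by exact_mod_cast hb
    exact Real.rpow_le_rpow (Real.log_nonneg hb1)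
      (Real.log_le_log (by linarith) (by exact_mod_cast hBb)) (by norm_num)
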